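/- Let $\Gamma$ be a nontrivial divisible ordered abelian group and $A\subseteq\Gamma$ a subgroup. A subset of $\Gamma\times\Gamma^n$ is called definable if it is a finite Boolean combination of sets given by linear inequalities with integer coefficients and parameters in $A$. Consider definable sets $F\subseteq\Gamma\times\Gamma^n$ ($n\ge 0$) such that every fibre $F(t)=\{x:(t,x)\in F\}$ is bounded and such that $F(t)=\emptyset$ for all $t$ below some $\gamma_0\in\Gamma$. Two such sets $F,F'$ (over the same $\Gamma^n$) are isomorphic if there are a finite partition of $F$ into definable pieces and a bijection $F\to F'$ over $\Gamma$ which on each piece has the form $(t,x)\mapsto(t,Mx+a+tk)$ with $M\in GL_n(\mathbb Z)$, $a\in A^n$, $k\in\mathbb Z^n$. The convolution of $F\subseteq\Gamma\times\Gamma^n$ and $G\subseteq\Gamma\times\Gamma^m$ is $F*G\subseteq\Gamma\times\Gamma^{n+m+1}$, with $$(F*G)(\gamma)=\{(\alpha,b,c):\alpha\in\Gamma,\ b\in F(\alpha),\ c\in G(\gamma-\alpha)\}.$$ Let $q(0)=\{0\}\times\Gamma^0$. Let ${\mathcal R}^\Gamma$ be the $\mathbb Q$-vector space generated by the symbols $[F]$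 subject to the relations $[F]=[F']$ for $F,F'$ isomorphic, $[F]=[F_1]+[F_2]$ if $F$ is the disjoint union of $F_1$ and $F_2$, and $[F*q(0)]=[F]$. With the product induced by convolution it is a commutative ring with unit $[q(0)]$: the convolution ring of definable functions, with support bounded below, from $\Gamma$ to the dimension-free Grothendieck ring, with rational coefficients, of bounded definable sets over $A$ (the class of $F\subseteq\Gamma\times\Gamma^n$ stands for the function $t\mapsto[F(t)]/[\{0\}]_1^n$). For an integer $m\ge1$ let $\theta_m=\int_{t\ge0}q(mt)\,dt\in{\mathcal R}^\Gamma$, where $q(\gamma)$ is the function supported on $\{\gamma\}$ with value $1$ there; that is, $\theta_m$ is the class of $\{(\gamma,t)\in\Gamma\times\Gamma: t\ge0,\ \gamma=mt\}$. Let $\theta=\theta_1$. Then for every integer $n\ge1$ one has in ${\mathcal R}^\Gamma$ $$\theta_{n+1}(\theta+\theta_n-1)=\theta_n\theta .$$ Moreover, $\theta_n$ is invertible in the localization ${\mathcal R}^\Gamma[\theta^{-1}]$, and there $$1-\theta_n^{-1}=(1-\theta^{-1})^n .$$ -/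

import Mathlib

set_option linter.unusedSectionVars false

namespace VolGamma

section Definable

variable {Γ : Type*} [AddCommGroup Γ] [LinearOrder Γ] [IsOrderedAddMonoid Γ]

/-- The integral affine function `(t, x) ↦ k t + ∑ cᵢ xᵢ + a` on `Γ × Γⁿ`. -/
def affineFn {n : ℕ} (k : ℤ) (c : Fin n → ℤ) (a : Γ) (p : Γ × (Fin n → Γ)) : Γ :=
  k • p.1 + ∑ i, c i • p.2 i + a

/-- Subsets of `Γ × Γⁿ` definable over `A`: the finite Boolean combinations of sets given by linear
inequalities with integer coefficients and parameters in `A`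
(closure under complements is `Definable.compl` below). -/
inductive Definable (A : AddSubgroup Γ) {n : ℕ} : Set (Γ × (Fin n → Γ)) → Prop
  | nonneg (k : ℤ) (c : Fin n → ℤ) (a : Γ) (ha : a ∈ A) : Definable A {p | 0 ≤ affineFn k c a p}
  | pos (k : ℤ) (c : Fin n → ℤ) (a : Γ) (ha : a ∈ A) : Definable A {p | 0 < affineFn k c a p}
  | union {X Y : Set (Γ × (Fin n → Γ))} : Definable A X → Definable A Y → Definable A (X ∪ Y)
  | inter {X Y : Set (Γ × (Fin n → Γ))} : Definable A X → Definable A Y → Definable A (X ∩ Y)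

theorem affineFn_neg {n : ℕ} (k : ℤ) (c : Fin n → ℤ) (a : Γ) (p : Γ × (Fin n → Γ)) :
    affineFn (-k) (-c) (-a) p = -affineFn k c a p := by
  simp only [affineFn, neg_smul, Pi.neg_apply, Finset.sum_neg_distrib]
  abel

theorem Definable.compl {A : AddSubgroup Γ} {n : ℕ} {X : Set (Γ × (Fin n → Γ))}
    (h : Definable A X) : Definable A Xᶜ := by
  induction h with
  | nonneg k c a ha =>
    convert Definable.pos (-k) (-c) (-a) (A.neg_mem ha) using 1
    ext p; simp [affineFn_neg]
  | pos k c a ha =>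
    convert Definable.nonneg (-k) (-c) (-a) (A.neg_mem ha) using 1
    ext p; simp [affineFn_neg]
  | union _ _ h₁ h₂ => rw [Set.compl_union]; exact h₁.inter h₂
  | inter _ _ h₁ h₂ => rw [Set.compl_inter]; exact h₁.union h₂

/-- A function on `Γ × Γⁿ` that is integral affine over `A`. -/
def IsAffine (A : AddSubgroup Γ) {n : ℕ} (f : Γ × (Fin n → Γ) → Γ) : Prop :=
  ∃ (k : ℤ) (c : Fin n → ℤ) (a : Γ), a ∈ A ∧ ∀ p, f p = affineFn k c a p

theorem IsAffine.const {A : AddSubgroup Γ} {n : ℕ} {a : Γ} (ha : a ∈ A) :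
    IsAffine A (fun _ : Γ × (Fin n → Γ) => a) :=
  ⟨0, 0, a, ha, fun p => by simp [affineFn]⟩

theorem IsAffine.fst {A : AddSubgroup Γ} {n : ℕ} :
    IsAffine A (fun p : Γ × (Fin n → Γ) => p.1) :=
  ⟨1, 0, 0, A.zero_mem, fun p => by simp [affineFn]⟩

theorem IsAffine.coord {A : AddSubgroup Γ} {n : ℕ} (i : Fin n) :
    IsAffine A (fun p : Γ × (Fin n → Γ) => p.2 i) :=
  ⟨0, Pi.single i 1, 0, A.zero_mem, fun p => by simp [affineFn, Pi.single_apply]⟩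

theorem IsAffine.add {A : AddSubgroup Γ} {n : ℕ} {f g : Γ × (Fin n → Γ) → Γ}
    (hf : IsAffine A f) (hg : IsAffine A g) : IsAffine A (fun p => f p + g p) := by
  obtain ⟨k, c, a, ha, h⟩ := hf
  obtain ⟨k', c', a', ha', h'⟩ := hg
  refine ⟨k + k', c + c', a + a', A.add_mem ha ha', fun p => ?_⟩
  simp only [h, h', affineFn, add_smul, Pi.add_apply, Finset.sum_add_distrib]
  abel

theorem IsAffine.zsmul {A : AddSubgroup Γ} {n : ℕ} {f : Γ × (Fin n → Γ) → Γ}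
    (hf : IsAffine A f) (z : ℤ) : IsAffine A (fun p => z • f p) := by
  obtain ⟨k, c, a, ha, h⟩ := hf
  refine ⟨z * k, fun i => z * c i, z • a, A.zsmul_mem ha z, fun p => ?_⟩
  simp only [h, affineFn, smul_add, mul_smul, Finset.smul_sum]

theorem IsAffine.sub {A : AddSubgroup Γ} {n : ℕ} {f g : Γ × (Fin n → Γ) → Γ}
    (hf : IsAffine A f) (hg : IsAffine A g) : IsAffine A (fun p => f p - g p) := by
  simpa [sub_eq_add_neg] using hf.add (hg.zsmul (-1))

theorem IsAffine.sum {A : AddSubgroup Γ} {n : ℕ} {ι : Type*} (s : Finset ι)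
    {f : ι → Γ × (Fin n → Γ) → Γ} (hf : ∀ i ∈ s, IsAffine A (f i)) :
    IsAffine A (fun p => ∑ i ∈ s, f i p) := by
  classical
  induction s using Finset.induction_on with
  | empty => simpa using IsAffine.const (n := n) A.zero_mem
  | insert i s hi ih =>
    simp only [Finset.sum_insert hi]
    exact (hf i (Finset.mem_insert_self _ _)).add
      (ih fun j hj => hf j (Finset.mem_insert_of_mem hj))

theorem Definable.nonneg_of_isAffine {A : AddSubgroup Γ} {n : ℕ} {f : Γ × (Fin n → Γ) → Γ}
    (hf : IsAffine A f) : Definable A {p | 0 ≤ f p} := by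
  obtain ⟨k, c, a, ha, h⟩ := hf
  simpa only [h] using Definable.nonneg k c a ha

theorem Definable.pos_of_isAffine {A : AddSubgroup Γ} {n : ℕ} {f : Γ × (Fin n → Γ) → Γ}
    (hf : IsAffine A f) : Definable A {p | 0 < f p} := by
  obtain ⟨k, c, a, ha, h⟩ := hf
  simpa only [h] using Definable.pos k c a ha

theorem Definable.eq_of_isAffine {A : AddSubgroup Γ} {n : ℕ} {f g : Γ × (Fin n → Γ) → Γ}
    (hf : IsAffine A f) (hg : IsAffine A g) : Definable A {p | f p = g p} := by
  convert (Definable.nonneg_of_isAffine (hf.sub hg)).inter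
    (Definable.nonneg_of_isAffine (hg.sub hf)) using 1
  ext p
  simp only [Set.mem_ofPred_eq, Set.mem_inter_iff, sub_nonneg]
  exact ⟨fun h => ⟨h.ge, h.le⟩, fun h => le_antisymm h.2 h.1⟩

/-- Definable sets pull back under integral affine maps. -/
theorem Definable.preimage {A : AddSubgroup Γ} {n m : ℕ} {X : Set (Γ × (Fin m → Γ))}
    (h : Definable A X) (φ : Γ × (Fin n → Γ) → Γ × (Fin m → Γ))
    (h₁ : IsAffine A fun p => (φ p).1) (h₂ : ∀ i, IsAffine A fun p => (φ p).2 i) :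
    Definable A (φ ⁻¹' X) := by
  have key : ∀ (k : ℤ) (c : Fin m → ℤ) (a : Γ), a ∈ A →
      IsAffine A fun p => affineFn k c a (φ p) := fun k c a ha =>
    ((h₁.zsmul k).add (IsAffine.sum _ fun i _ => (h₂ i).zsmul (c i))).add (IsAffine.const ha)
  induction h with
  | nonneg k c a ha => exact Definable.nonneg_of_isAffine (key k c a ha)
  | pos k c a ha => exact Definable.pos_of_isAffine (key k c a ha)
  | union _ _ h₁ h₂ => exact h₁.union h₂
  | inter _ _ h₁ h₂ => exact h₁.inter h₂

end Definable

section Bounded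

/-- Farkas' lemma over `ℚ`: a linear form that is nonnegative wherever all members of `L` are
lies in every convex cone that contains `L`. -/
theorem farkas {V : Type*} [AddCommGroup V] [Module ℚ V] (N : ℕ) :
    ∀ (L : List (V →ₗ[ℚ] ℚ)), L.length = N →
    ∀ (φ : V →ₗ[ℚ] ℚ), (∀ v, (∀ l ∈ L, 0 ≤ l v) → 0 ≤ φ v) →
    ∀ S : Set (V →ₗ[ℚ] ℚ), 0 ∈ S → (∀ f ∈ S, ∀ g ∈ S, f + g ∈ S) →
      (∀ r : ℚ, 0 ≤ r → ∀ f ∈ S, r • f ∈ S) → (∀ l ∈ L, l ∈ S) → φ ∈ S := by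
  induction N with
  | zero =>
    intro L hN φ h S h0 _ _ _
    obtain rfl := List.length_eq_zero_iff.mp hN
    have : φ = 0 := by
      ext v
      have h1 := h v (by simp)
      have h2 := h (-v) (by simp)
      rw [map_neg] at h2
      exact le_antisymm (by simpa using h2) h1
    rwa [this]
  | succ N ih =>
    intro L hN φ h S h0 hadd hsmul hL
    obtain ⟨b, L, rfl⟩ := List.exists_cons_of_length_eq_add_one hN
    have hN : L.length = N := by simpa using hN
    by_cases hφ : ∀ v, (∀ l ∈ L, 0 ≤ l v) → 0 ≤ φ v
    · exact ih L hN φ hφ S h0 hadd hsmul fun l hl => hL l (List.mem_cons_of_mem _ hl)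
    push Not at hφ
    obtain ⟨w, hw, hφw⟩ := hφ
    have hbw : b w < 0 := by
      by_contra hb
      push Not at hb
      refine absurd (h w fun l hl => ?_) (not_le.mpr hφw)
      rcases List.mem_cons.mp hl with rfl | hl
      · exact hb
      · exact hw l hl
    set y : V := (-(b w))⁻¹ • w with hy
    have hpos : 0 < (-(b w))⁻¹ := inv_pos.mpr (by linarith)
    have hby : b y = -1 := by
      rw [hy, map_smul, smul_eq_mul, inv_neg, neg_mul, inv_mul_cancel₀ hbw.ne]
    have hLy : ∀ l ∈ L, 0 ≤ l y := fun l hl => by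
      rw [hy, map_smul, smul_eq_mul]
      exact mul_nonneg hpos.le (hw l hl)
    have hφy : φ y < 0 := by
      rw [hy, map_smul, smul_eq_mul]
      exact mul_neg_of_pos_of_neg hpos hφw
    let T : (V →ₗ[ℚ] ℚ) → (V →ₗ[ℚ] ℚ) := fun f => f + f y • b
    have hT : ∀ f v, T f v = f (v + b v • y) := fun f v => by
      simp [T, mul_comm]
    obtain ⟨ψ, hψS, hψy, hψ⟩ : T φ ∈ {χ | ∃ ψ ∈ S, 0 ≤ ψ y ∧ T ψ = χ} := by
      refine ih (L.map T) (by simpa using hN) (T φ) (fun v hv => ?_) _ ?_ ?_ ?_ ?_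
      · rw [hT]
        refine h _ fun l hl => ?_
        rcases List.mem_cons.mp hl with rfl | hl
        · simp [hby]
        · rw [← hT]
          exact hv _ (List.mem_map_of_mem hl)
      · exact ⟨0, h0, by simp, by simp [T]⟩
      · rintro _ ⟨f, hf, hfy, rfl⟩ _ ⟨g, hg, hgy, rfl⟩
        refine ⟨f + g, hadd _ hf _ hg, by simpa using add_nonneg hfy hgy, ?_⟩
        simp only [T, LinearMap.add_apply, add_smul]
        abel
      · rintro r hr _ ⟨f, hf, hfy, rfl⟩
        refine ⟨r • f, hsmul r hr f hf, by simpa using mul_nonneg hr hfy, ?_⟩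
        simp only [T, LinearMap.smul_apply, smul_add, smul_assoc]
      · intro l hl
        obtain ⟨f, hf, rfl⟩ := List.mem_map.mp hl
        exact ⟨f, hL f (List.mem_cons_of_mem _ hf), hLy f hf, rfl⟩
    have : φ = ψ + (ψ y - φ y) • b := by
      have h1 : ψ + ψ y • b = φ + φ y • b := hψ
      rw [sub_smul, ← add_sub_assoc, h1, add_sub_cancel_right]
    rw [this]
    exact hadd _ hψS _ (hsmul _ (by linarith) _ (hL b (by simp)))

variable {Γ : Type*} [AddCommGroup Γ] [LinearOrder Γ] [IsOrderedAddMonoid Γ] [Module ℚ Γ]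

theorem rat_smul_nonneg {r : ℚ} (hr : 0 ≤ r) {x : Γ} (hx : 0 ≤ x) : 0 ≤ r • x := by
  by_contra h
  push Not at h
  have h1 : r.den • (r • x) < 0 := nsmul_neg h r.den_nz
  have h2 : r.den • (r • x) = r.num.toNat • x := by
    rw [← Nat.cast_smul_eq_nsmul ℚ, smul_smul, ← Nat.cast_smul_eq_nsmul ℚ r.num.toNat]
    congr 1
    rw [mul_comm, Rat.mul_den_eq_num]
    exact_mod_cast (Int.toNat_of_nonneg (Rat.num_nonneg.mpr hr)).symm
  rw [h2] at h1
  exact absurd h1 (not_lt.mpr (nsmul_nonneg hx _))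

/-- A set cut out by finitely many linear inequalities, some of which may be strict. -/
def IsCell {n : ℕ} (P : Set (Γ × (Fin n → Γ))) : Prop :=
  ∃ L : List (ℤ × (Fin n → ℤ) × Γ), (∀ p ∈ P, ∀ l ∈ L, 0 ≤ affineFn l.1 l.2.1 l.2.2 p) ∧
    ∀ p ∈ P, ∀ q, (∀ l ∈ L, affineFn l.1 l.2.1 l.2.2 p ≤ affineFn l.1 l.2.1 l.2.2 q) → q ∈ P

theorem IsCell.inter {n : ℕ} {P Q : Set (Γ × (Fin n → Γ))} (hP : IsCell P) (hQ : IsCell Q) :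
    IsCell (P ∩ Q) := by
  obtain ⟨L, h, h'⟩ := hP
  obtain ⟨M, k, k'⟩ := hQ
  refine ⟨L ++ M, fun p hp l hl => ?_, fun p hp q hq => ⟨?_, ?_⟩⟩
  · rcases List.mem_append.mp hl with hl | hl
    · exact h p hp.1 l hl
    · exact k p hp.2 l hl
  · exact h' p hp.1 q fun l hl => hq l (List.mem_append_left _ hl)
  · exact k' p hp.2 q fun l hl => hq l (List.mem_append_right _ hl)

theorem Definable.exists_cells {A : AddSubgroup Γ} {n : ℕ} {X : Set (Γ × (Fin n → Γ))}
    (h : Definable A X) :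
    ∃ S : Set (Set (Γ × (Fin n → Γ))), S.Finite ∧ (∀ P ∈ S, IsCell P) ∧ X = ⋃₀ S := by
  induction h with
  | nonneg k c a ha =>
    refine ⟨{{p | 0 ≤ affineFn k c a p}}, Set.finite_singleton _, ?_, by simp⟩
    rintro P rfl
    exact ⟨[(k, c, a)], fun p hp l hl => by simpa [List.mem_singleton.mp hl] using hp,
      fun p hp q hq => le_trans hp (hq _ (List.mem_singleton_self _))⟩
  | pos k c a ha =>
    refine ⟨{{p | 0 < affineFn k c a p}}, Set.finite_singleton _, ?_, by simp⟩
    rintro P rfl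
    exact ⟨[(k, c, a)], fun p hp l hl => by simpa [List.mem_singleton.mp hl] using le_of_lt hp,
      fun p hp q hq => lt_of_lt_of_le hp (hq _ (List.mem_singleton_self _))⟩
  | union _ _ h₁ h₂ =>
    obtain ⟨S, hS, hS', rfl⟩ := h₁
    obtain ⟨T, hT, hT', rfl⟩ := h₂
    exact ⟨S ∪ T, hS.union hT, fun P hP => hP.elim (hS' P) (hT' P), Set.sUnion_union S T ▸ rfl⟩
  | inter _ _ h₁ h₂ =>
    obtain ⟨S, hS, hS', rfl⟩ := h₁
    obtain ⟨T, hT, hT', rfl⟩ := h₂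
    refine ⟨Set.image2 (· ∩ ·) S T, hS.image2 _ hT, ?_, ?_⟩
    · rintro _ ⟨P, hP, Q, hQ, rfl⟩
      exact (hS' P hP).inter (hT' Q hQ)
    · ext p
      simp only [Set.mem_inter_iff, Set.mem_sUnion, Set.mem_image2]
      constructor
      · rintro ⟨⟨P, hP, hp⟩, Q, hQ, hp'⟩
        exact ⟨_, ⟨P, hP, Q, hQ, rfl⟩, hp, hp'⟩
      · rintro ⟨_, ⟨P, hP, Q, hQ, rfl⟩, hp, hp'⟩
        exact ⟨⟨P, hP, hp⟩, Q, hQ, hp'⟩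

/-- The value at `x ∈ Γⁿ` of a rational linear form. -/
def formVal {n : ℕ} (φ : (Fin n → ℚ) →ₗ[ℚ] ℚ) (x : Fin n → Γ) : Γ :=
  ∑ i, φ (Pi.single i 1) • x i

theorem formVal_proj {n : ℕ} (i : Fin n) (x : Fin n → Γ) :
    formVal (LinearMap.proj i) x = x i := by
  simp [formVal, Pi.single_apply]

/-- The fibres of a cell over an interval are bounded by a common bound in each coordinate
direction, once every fibre is bounded. -/
theorem IsCell.exists_lower_bound [Nontrivial Γ] {n : ℕ} {P : Set (Γ × (Fin n → Γ))}
    (hP : IsCell P) (hb : ∀ t, ∃ γ : Γ, ∀ x, (t, x) ∈ P → ∀ i, |x i| ≤ γ) (B : Γ)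
    (φ : (Fin n → ℚ) →ₗ[ℚ] ℚ) (hφ : ∃ i, φ = LinearMap.proj i ∨ φ = -LinearMap.proj i) :
    ∃ C : Γ, 0 ≤ C ∧ ∀ p ∈ P, |p.1| ≤ B → -C ≤ formVal φ p.2 := by
  rcases Set.eq_empty_or_nonempty P with rfl | ⟨⟨t₀, x₀⟩, h₀⟩
  · exact ⟨0, le_rfl, by simp⟩
  obtain ⟨L, hL, hL'⟩ := hP
  let form : ℤ × (Fin n → ℤ) × Γ → ((Fin n → ℚ) →ₗ[ℚ] ℚ) := fun l =>
    ∑ i, (l.2.1 i : ℚ) • LinearMap.proj i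
  have hform : ∀ l i, form l (Pi.single i 1) = l.2.1 i := fun l i => by
    simp [form, Pi.single_apply]
  refine farkas _ (L.map form) rfl φ ?_
    {ψ | ∃ C : Γ, 0 ≤ C ∧ ∀ p ∈ P, |p.1| ≤ B → -C ≤ formVal ψ p.2} ?_ ?_ ?_ ?_
  · intro v hv
    by_contra hneg
    push Not at hneg
    obtain ⟨i, hi⟩ := hφ
    have hvi : v i ≠ 0 := by
      rcases hi with rfl | rfl
      · exact (show v i < 0 by simpa using hneg).ne
      · exact (show 0 < v i by simpa using hneg).ne'
    obtain ⟨γ, hγ⟩ := hb t₀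
    obtain ⟨ε, hε⟩ : ∃ ε : Γ, 0 < ε := by
      obtain ⟨z, hz⟩ := exists_ne (0 : Γ)
      exact ⟨|z|, abs_pos.mpr hz⟩
    set W : Γ := γ + |x₀ i| + ε with hW
    have hWpos : 0 ≤ W :=
      add_nonneg (add_nonneg ((abs_nonneg _).trans (hγ x₀ h₀ i)) (abs_nonneg _)) hε.le
    set g : Γ := |v i|⁻¹ • W with hg
    have hg0 : 0 ≤ g := rat_smul_nonneg (inv_nonneg.mpr (abs_nonneg _)) hWpos
    have hgv : |v i • g| = W := by
      rw [hg, smul_smul]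
      rcases lt_or_gt_of_ne hvi with h | h
      · rw [abs_of_neg h, inv_neg, mul_neg, mul_inv_cancel₀ hvi, neg_smul, one_smul, abs_neg,
          abs_of_nonneg hWpos]
      · rw [abs_of_pos h, mul_inv_cancel₀ hvi, one_smul, abs_of_nonneg hWpos]
    have hmem : (t₀, fun j => x₀ j + v j • g) ∈ P := by
      refine hL' _ h₀ _ fun l hl => ?_
      have h1 : ∑ j, l.2.1 j • (v j • g) = (form l v) • g := by
        simp only [form, LinearMap.sum_apply, LinearMap.smul_apply, LinearMap.proj_apply,
          Finset.sum_smul, Int.cast_smul_eq_zsmul, smul_assoc]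
      have h2 : 0 ≤ (form l v) • g :=
        rat_smul_nonneg (hv _ (List.mem_map_of_mem hl)) hg0
      simp only [affineFn, smul_add, Finset.sum_add_distrib, h1]
      refine add_le_add (add_le_add le_rfl ?_) le_rfl
      exact le_add_of_nonneg_right h2
    have h3 := hγ _ hmem i
    have h4 : W ≤ γ + |x₀ i| := by
      calc W = |v i • g| := hgv.symm
        _ = |(x₀ i + v i • g) - x₀ i| := by rw [add_sub_cancel_left]
        _ ≤ |x₀ i + v i • g| + |x₀ i| := abs_sub _ _
        _ ≤ γ + |x₀ i| := add_le_add h3 le_rfl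
    exact absurd h4 (not_le.mpr (lt_add_of_pos_right _ hε))
  · exact ⟨0, le_rfl, fun p _ _ => by simp [formVal]⟩
  · rintro f ⟨C, hC, h⟩ g ⟨D, hD, k⟩
    refine ⟨C + D, add_nonneg hC hD, fun p hp hpB => ?_⟩
    have : formVal (f + g) p.2 = formVal f p.2 + formVal g p.2 := by
      simp [formVal, add_smul, Finset.sum_add_distrib]
    rw [this, neg_add]
    exact add_le_add (h p hp hpB) (k p hp hpB)
  · rintro r hr f ⟨C, hC, h⟩
    refine ⟨r • C, rat_smul_nonneg hr hC, fun p hp hpB => ?_⟩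
    have : formVal (r • f) p.2 = r • formVal f p.2 := by
      simp [formVal, mul_smul, Finset.smul_sum]
    rw [this, ← sub_nonneg, sub_neg_eq_add, ← smul_add]
    refine rat_smul_nonneg hr ?_
    have := h p hp hpB
    rwa [← sub_nonneg, sub_neg_eq_add] at this
  · intro l hl
    obtain ⟨l, hmem, rfl⟩ := List.mem_map.mp hl
    refine ⟨|l.1| • |B| + |l.2.2|,
      add_nonneg (zsmul_nonneg (abs_nonneg _) (abs_nonneg _)) (abs_nonneg _), fun p hp hpB => ?_⟩
    have h1 := hL p hp l hmem
    have h2 : formVal (form l) p.2 = ∑ i, l.2.1 i • p.2 i := by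
      simp [formVal, hform, Int.cast_smul_eq_zsmul]
    have h3 : l.1 • p.1 ≤ |l.1| • |B| := by
      calc l.1 • p.1 ≤ |l.1 • p.1| := le_abs_self _
        _ = |l.1| • |p.1| := abs_zsmul _ _
        _ ≤ |l.1| • |B| := zsmul_le_zsmul_right (abs_nonneg _) (hpB.trans (le_abs_self _))
    rw [h2, neg_le_iff_add_nonneg]
    refine h1.trans ?_
    rw [affineFn, add_comm (l.1 • p.1), add_assoc]
    exact add_le_add le_rfl (add_le_add h3 (le_abs_self _))

/-- A definable subset of `Γ × Γⁿ` with bounded fibres is bounded over every interval. -/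
theorem Definable.bounded [Nontrivial Γ] {A : AddSubgroup Γ} {n : ℕ}
    {X : Set (Γ × (Fin n → Γ))} (h : Definable A X)
    (hb : ∀ t, ∃ γ : Γ, ∀ x, (t, x) ∈ X → ∀ i, |x i| ≤ γ) (B : Γ) :
    ∃ C : Γ, 0 ≤ C ∧ ∀ p ∈ X, |p.1| ≤ B → ∀ i, |p.2 i| ≤ C := by
  obtain ⟨S, hS, hcell, rfl⟩ := h.exists_cells
  have key : ∀ P ∈ S, ∀ i, ∃ C : Γ, 0 ≤ C ∧ ∀ p ∈ P, |p.1| ≤ B → |p.2 i| ≤ C := by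
    intro P hP i
    have hb' : ∀ t, ∃ γ : Γ, ∀ x, (t, x) ∈ P → ∀ i, |x i| ≤ γ := fun t => by
      obtain ⟨γ, hγ⟩ := hb t
      exact ⟨γ, fun x hx => hγ x ⟨P, hP, hx⟩⟩
    obtain ⟨C, hC, h₁⟩ := (hcell P hP).exists_lower_bound hb' B _ ⟨i, Or.inl rfl⟩
    obtain ⟨D, hD, h₂⟩ := (hcell P hP).exists_lower_bound hb' B _ ⟨i, Or.inr rfl⟩
    refine ⟨C + D, add_nonneg hC hD, fun p hp hpB => abs_le.mpr ⟨?_, ?_⟩⟩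
    · have := h₁ p hp hpB
      rw [formVal_proj] at this
      exact le_trans (neg_le_neg (le_add_of_nonneg_right hD)) this
    · have := h₂ p hp hpB
      have h3 : formVal (-LinearMap.proj i) p.2 = -p.2 i := by
        rw [← formVal_proj i p.2]
        simp [formVal]
      rw [h3, neg_le_neg_iff] at this
      exact le_trans this (le_add_of_nonneg_left hC)
  choose! C hC h using key
  refine ⟨∑ P ∈ hS.toFinset, ∑ i, C P i, ?_, ?_⟩
  · exact Finset.sum_nonneg fun P hP => Finset.sum_nonneg fun i _ =>
      hC P (hS.mem_toFinset.mp hP) i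
  · rintro p ⟨P, hP, hp⟩ hpB i
    refine (h P hP i p hp hpB).trans ?_
    have h1 : C P i ≤ ∑ i, C P i :=
      Finset.single_le_sum (fun i _ => hC P hP i) (Finset.mem_univ i)
    exact h1.trans (Finset.single_le_sum (f := fun P => ∑ i, C P i)
      (fun Q hQ => Finset.sum_nonneg fun i _ => hC Q (hS.mem_toFinset.mp hQ) i)
      (hS.mem_toFinset.mpr hP))

end Bounded

section Functions

variable {Γ : Type*} [AddCommGroup Γ] [LinearOrder Γ] [IsOrderedAddMonoid Γ] [Module ℚ Γ]
  [Nontrivial Γ]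

/-- Here and below `Γ` is a nontrivial divisible ordered abelian group, divisibility being expressed
by the (unique) `ℚ`-vector space structure. A representative of a definable function `t ↦ F(t)`
from `Γ` to bounded definable subsets of
`Γⁿ`, with support bounded below. -/
@[ext]
structure DefFn (A : AddSubgroup Γ) (n : ℕ) where
  carrier : Set (Γ × (Fin n → Γ))
  definable : Definable A carrier
  bounded : ∀ t, ∃ γ : Γ, ∀ x, (t, x) ∈ carrier → ∀ i, |x i| ≤ γ
  support_bddBelow : ∃ γ₀ : Γ, ∀ p ∈ carrier, γ₀ ≤ p.1

/-- An isomorphism of families over `Γ`: a fibrewise bijection `F(t) → F'(t)` which on each piece of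
a finite definable partition is `x ↦ M x + a + t k`, where `M` is an invertible integer matrix and
`a + t k` is a vector with entries in the group generated by `A` and `t`. (The matrix is square of
size `n = m` whenever the families are nonempty. By compactness, such a definable family of
isomorphisms exists as soon as, for each point `t` of each extension of `Γ`, the fibres over `t` are
isomorphic over the group generated by `A` and `t`; so isomorphic families are the same as pointwise
equal functions.) -/
def DefFn.Iso {A : AddSubgroup Γ} {n m : ℕ} (F : DefFn A n) (F' : DefFn A m) : Prop :=
  ∃ f : Γ × (Fin n → Γ) → Γ × (Fin m → Γ), Set.BijOn f F.carrier F'.carrier ∧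
    ∃ (r : ℕ) (P : Fin r → Set (Γ × (Fin n → Γ))),
      (∀ j, Definable A (P j)) ∧ Pairwise (fun i j => Disjoint (P i) (P j)) ∧
      F.carrier = ⋃ j, P j ∧
      ∀ j, ∃ (M : Matrix (Fin m) (Fin n) ℤ) (N : Matrix (Fin n) (Fin m) ℤ)
        (a : Fin m → Γ) (k : Fin m → ℤ), M * N = 1 ∧ N * M = 1 ∧ (∀ i, a i ∈ A) ∧
        ∀ p ∈ P j, f p = (p.1, fun i => ∑ l, M i l • p.2 l + a i + k i • p.1)

/-- The point `(α, b)` attached to the point `(γ, (α, b, c))`. -/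
def convLeft (n m : ℕ) (p : Γ × (Fin (n + m + 1) → Γ)) : Γ × (Fin n → Γ) :=
  (p.2 0, fun i => p.2 (Fin.castAdd m i).succ)

/-- The point `(γ - α, c)` attached to the point `(γ, (α, b, c))`. -/
def convRight (n m : ℕ) (p : Γ × (Fin (n + m + 1) → Γ)) : Γ × (Fin m → Γ) :=
  (p.1 - p.2 0, fun j => p.2 (Fin.natAdd n j).succ)

theorem Definable.convLeft {A : AddSubgroup Γ} {n : ℕ} (m : ℕ) {X : Set (Γ × (Fin n → Γ))}
    (h : Definable A X) : Definable A (convLeft n m ⁻¹' X) :=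
  h.preimage _ (IsAffine.coord _) fun _ => IsAffine.coord _

theorem Definable.convRight {A : AddSubgroup Γ} (n : ℕ) {m : ℕ} {X : Set (Γ × (Fin m → Γ))}
    (h : Definable A X) : Definable A (convRight n m ⁻¹' X) :=
  h.preimage _ (IsAffine.fst.sub (IsAffine.coord _)) fun _ => IsAffine.coord _

/-- Convolution: `(F * G)(γ) = {(α, b, c) : b ∈ F(α), c ∈ G(γ - α)}`. -/
def DefFn.conv {A : AddSubgroup Γ} {n m : ℕ} (F : DefFn A n) (G : DefFn A m) :
    DefFn A (n + m + 1) where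
  carrier := {p | convLeft n m p ∈ F.carrier ∧ convRight n m p ∈ G.carrier}
  definable := (F.definable.convLeft m).inter (G.definable.convRight n)
  bounded t := by
    obtain ⟨u, hu⟩ := F.support_bddBelow
    obtain ⟨v, hv⟩ := G.support_bddBelow
    obtain ⟨C, hC, hF⟩ := F.definable.bounded F.bounded (|u| + |t - v|)
    obtain ⟨D, hD, hG⟩ := G.definable.bounded G.bounded (|v| + |t - u|)
    refine ⟨(|u| + |t - v|) + C + D, fun x hx i => ?_⟩
    have h0 : 0 ≤ |u| + |t - v| := add_nonneg (abs_nonneg _) (abs_nonneg _)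
    have h1 : u ≤ x 0 := hu _ hx.1
    have h2 : v ≤ t - x 0 := hv _ hx.2
    have h3 : |x 0| ≤ |u| + |t - v| := by
      refine abs_le.mpr ⟨?_, ?_⟩
      · rw [neg_add]
        exact (add_le_of_nonpos_right (neg_nonpos.mpr (abs_nonneg _))).trans
          ((neg_abs_le u).trans h1)
      · exact (le_sub_comm.mp h2).trans
          ((le_abs_self _).trans (le_add_of_nonneg_left (abs_nonneg _)))
    have h4 : |t - x 0| ≤ |v| + |t - u| := by
      refine abs_le.mpr ⟨?_, ?_⟩
      · rw [neg_add]
        exact (add_le_of_nonpos_right (neg_nonpos.mpr (abs_nonneg _))).trans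
          ((neg_abs_le v).trans h2)
      · exact (sub_le_sub_left h1 t).trans
          ((le_abs_self _).trans (le_add_of_nonneg_left (abs_nonneg _)))
    refine Fin.cases ?_ (fun i => ?_) i
    · exact h3.trans ((le_add_of_nonneg_right hC).trans (le_add_of_nonneg_right hD))
    · refine Fin.addCases (fun i => ?_) (fun j => ?_) i
      · exact (hF _ hx.1 h3 i).trans
          ((le_add_of_nonneg_left h0).trans (le_add_of_nonneg_right hD))
      · exact (hG _ hx.2 h4 j).trans (le_add_of_nonneg_left (add_nonneg h0 hC))
  support_bddBelow := by
    obtain ⟨u, hu⟩ := F.support_bddBelow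
    obtain ⟨v, hv⟩ := G.support_bddBelow
    refine ⟨u + v, fun p hp => ?_⟩
    have := add_le_add (hu _ hp.1) (hv _ hp.2)
    simpa [convLeft, convRight] using this

/-- The graph of the function `q(γ)`, supported on `{γ}` and with value the one-point set `Γ⁰` there. -/
def qSet (γ : Γ) : Set (Γ × (Fin 0 → Γ)) := {p | p.1 = γ}

/-- The function `q(0)`. -/
def DefFn.q₀ (A : AddSubgroup Γ) : DefFn A 0 where
  carrier := qSet 0
  definable := Definable.eq_of_isAffine IsAffine.fst (IsAffine.const A.zero_mem)
  bounded _ := ⟨0, fun _ _ i => i.elim0⟩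
  support_bddBelow := ⟨0, fun _ hp => hp.ge⟩

/-- The integral `∫_{t ∈ Y} h(t) dt`, i.e. `γ ↦ {(t, y) : t ∈ Y, y ∈ h(t)(γ)}`. -/
def integralSet {n : ℕ} (Y : Set Γ) (h : Γ → Set (Γ × (Fin n → Γ))) :
    Set (Γ × (Fin (n + 1) → Γ)) :=
  {p | p.2 0 ∈ Y ∧ (p.1, Fin.tail p.2) ∈ h (p.2 0)}

/-- The function `θ_m = ∫_{t ≥ 0} q(m t) dt`. -/
def DefFn.theta (A : AddSubgroup Γ) (m : ℕ+) : DefFn A 1 where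
  carrier := integralSet {t | 0 ≤ t} fun t => qSet ((m : ℕ) • t)
  definable := by
    have := (Definable.nonneg_of_isAffine (A := A) (IsAffine.coord (n := 1) 0)).inter
      (Definable.eq_of_isAffine IsAffine.fst ((IsAffine.coord (n := 1) 0).zsmul (m : ℕ)))
    simp only [natCast_zsmul] at this
    exact this
  bounded t := by
    refine ⟨|t|, fun x hx i => ?_⟩
    obtain ⟨h0, h1⟩ := hx
    obtain rfl : i = 0 := Subsingleton.elim _ _
    have h1 : t = (m : ℕ) • x 0 := h1
    have h2 : 0 ≤ x 0 := h0
    rw [h1, abs_of_nonneg h2, abs_of_nonneg (nsmul_nonneg h2 _)]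
    exact le_self_nsmul h2 m.ne_zero
  support_bddBelow := by
    refine ⟨0, fun p hp => ?_⟩
    obtain ⟨h0, h1⟩ := hp
    have h1 : p.1 = (m : ℕ) • p.2 0 := h1
    rw [h1]
    exact nsmul_nonneg h0 _

/-- An isomorphism given by one integral affine map. -/
theorem DefFn.Iso.of_affine {A : AddSubgroup Γ} {n m : ℕ} {F : DefFn A n} {F' : DefFn A m}
    (f : Γ × (Fin n → Γ) → Γ × (Fin m → Γ)) (g : Γ × (Fin m → Γ) → Γ × (Fin n → Γ))
    (hf : ∀ p ∈ F.carrier, f p ∈ F'.carrier) (hg : ∀ p ∈ F'.carrier, g p ∈ F.carrier)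
    (hgf : ∀ p ∈ F.carrier, g (f p) = p) (hfg : ∀ p ∈ F'.carrier, f (g p) = p)
    (M : Matrix (Fin m) (Fin n) ℤ) (N : Matrix (Fin n) (Fin m) ℤ) (k : Fin m → ℤ)
    (hMN : ∀ v, M.mulVec (N.mulVec v) = v) (hNM : ∀ v, N.mulVec (M.mulVec v) = v)
    (h : ∀ p, f p = (p.1, fun i => ∑ l, M i l • p.2 l + k i • p.1)) : F.Iso F' := by
  refine ⟨f, Set.InvOn.bijOn ⟨hgf, hfg⟩ hf hg, 1, fun _ => F.carrier, fun _ => F.definable, ?_,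
    (Set.iUnion_const _).symm, fun _ => ⟨M, N, 0, k, ?_, ?_, fun _ => A.zero_mem, fun p _ => ?_⟩⟩
  · exact fun i j hij => absurd (Subsingleton.elim i j) hij
  · exact Matrix.ext_iff_mulVec.mpr fun v => by rw [← Matrix.mulVec_mulVec, hMN, Matrix.one_mulVec]
  · exact Matrix.ext_iff_mulVec.mpr fun v => by rw [← Matrix.mulVec_mulVec, hNM, Matrix.one_mulVec]
  · simp [h]

theorem DefFn.conv_comm {A : AddSubgroup Γ} {n m : ℕ} (F : DefFn A n) (G : DefFn A m) :
    (F.conv G).Iso (G.conv F) := by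
  let f (n m : ℕ) (p : Γ × (Fin (n + m + 1) → Γ)) : Γ × (Fin (m + n + 1) → Γ) :=
    (p.1, Fin.cons (p.1 - p.2 0) (Fin.append (fun j => p.2 (Fin.natAdd n j).succ)
      (fun i => p.2 (Fin.castAdd m i).succ)))
  let M (n m : ℕ) : Matrix (Fin (m + n + 1)) (Fin (n + m + 1)) ℤ :=
    Fin.cons (Pi.single 0 (-1)) (Fin.append (fun j => Pi.single (Fin.natAdd n j).succ 1)
      (fun i => Pi.single (Fin.castAdd m i).succ 1))
  have hf : ∀ {n m : ℕ} (F : DefFn A n) (G : DefFn A m), ∀ p ∈ (F.conv G).carrier,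
      f n m p ∈ (G.conv F).carrier := by
    intro n m F G p hp
    refine ⟨?_, ?_⟩
    · simpa [convLeft, convRight, f] using hp.2
    · simpa [convLeft, convRight, f] using hp.1
  have hff : ∀ n m p, f m n (f n m p) = p := by
    intro n m p
    refine Prod.ext rfl (funext fun i => ?_)
    refine Fin.cases (by simp [f]) (fun i => ?_) i
    refine Fin.addCases (fun i => by simp [f]) (fun j => by simp [f]) i
  have hMM : ∀ n m v, (M m n).mulVec ((M n m).mulVec v) = v := by
    intro n m v
    funext i
    refine Fin.cases (by simp [M, Matrix.mulVec]) (fun i => ?_) i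
    refine Fin.addCases (fun i => by simp [M, Matrix.mulVec])
      (fun j => by simp [M, Matrix.mulVec]) i
  refine DefFn.Iso.of_affine (f n m) (f m n) (hf F G) (hf G F) (fun p _ => hff n m p)
    (fun p _ => hff m n p) (M n m) (M m n) (Fin.cons 1 0) (hMM m n) (hMM n m) fun p => ?_
  refine Prod.ext rfl (funext fun i => ?_)
  refine Fin.cases (by simp [f, M, Pi.single_apply]; abel) (fun i => ?_) i
  refine Fin.addCases (fun i => by simp [f, M, Pi.single_apply])
    (fun j => by simp [f, M, Pi.single_apply]) i

theorem DefFn.conv_assoc {A : AddSubgroup Γ} {n m l : ℕ} (F : DefFn A n) (G : DefFn A m)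
    (H : DefFn A l) : ((F.conv G).conv H).Iso (F.conv (G.conv H)) := by
  let f (p : Γ × (Fin (n + m + 1 + l + 1) → Γ)) : Γ × (Fin (n + (m + l + 1) + 1) → Γ) :=
    (p.1, Fin.cons (p.2 (Fin.castAdd l 0).succ)
      (Fin.append (fun i => p.2 (Fin.castAdd l (Fin.castAdd m i).succ).succ)
        (Fin.cons (p.2 0 - p.2 (Fin.castAdd l 0).succ)
          (Fin.append (fun j => p.2 (Fin.castAdd l (Fin.natAdd n j).succ).succ)
            (fun k => p.2 (Fin.natAdd (n + m + 1) k).succ)))))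
  let g (p : Γ × (Fin (n + (m + l + 1) + 1) → Γ)) : Γ × (Fin (n + m + 1 + l + 1) → Γ) :=
    (p.1, Fin.cons (p.2 0 + p.2 (Fin.natAdd n 0).succ)
      (Fin.append (Fin.cons (p.2 0) (Fin.append (fun i => p.2 (Fin.castAdd (m + l + 1) i).succ)
        (fun j => p.2 (Fin.natAdd n (Fin.castAdd l j).succ).succ)))
        (fun k => p.2 (Fin.natAdd n (Fin.natAdd m k).succ).succ)))
  let M : Matrix (Fin (n + (m + l + 1) + 1)) (Fin (n + m + 1 + l + 1)) ℤ :=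
    Fin.cons (Pi.single (Fin.castAdd l 0).succ 1)
      (Fin.append (fun i => Pi.single (Fin.castAdd l (Fin.castAdd m i).succ).succ 1)
        (Fin.cons (Pi.single 0 1 - Pi.single (Fin.castAdd l 0).succ 1)
          (Fin.append (fun j => Pi.single (Fin.castAdd l (Fin.natAdd n j).succ).succ 1)
            (fun k => Pi.single (Fin.natAdd (n + m + 1) k).succ 1))))
  let N : Matrix (Fin (n + m + 1 + l + 1)) (Fin (n + (m + l + 1) + 1)) ℤ :=
    Fin.cons (Pi.single 0 1 + Pi.single (Fin.natAdd n 0).succ 1)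
      (Fin.append (Fin.cons (Pi.single 0 1)
        (Fin.append (fun i => Pi.single (Fin.castAdd (m + l + 1) i).succ 1)
        (fun j => Pi.single (Fin.natAdd n (Fin.castAdd l j).succ).succ 1)))
        (fun k => Pi.single (Fin.natAdd n (Fin.natAdd m k).succ).succ 1))
  refine DefFn.Iso.of_affine f g (fun p hp => ?_) (fun p hp => ?_) (fun p _ => ?_) (fun p _ => ?_)
    M N 0 (fun v => ?_) (fun v => ?_) fun p => ?_
  · obtain ⟨⟨h1, h2⟩, h3⟩ := hp
    refine ⟨?_, ?_, ?_⟩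
    · simpa [convLeft, convRight, f] using h1
    · simpa [convLeft, convRight, f] using h2
    · simpa [convLeft, convRight, f] using h3
  · obtain ⟨h1, h2, h3⟩ := hp
    refine ⟨⟨?_, ?_⟩, ?_⟩
    · simpa [convLeft, convRight, g] using h1
    · simpa [convLeft, convRight, g] using h2
    · simpa [convLeft, convRight, g, sub_sub] using h3
  · refine Prod.ext rfl (funext fun i => ?_)
    refine Fin.cases (by simp [f, g]) (fun i => ?_) i
    refine Fin.addCases (fun i => ?_) (fun k => by simp [f, g]) i
    refine Fin.cases (by simp [f, g]) (fun i => ?_) i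
    exact Fin.addCases (fun i => by simp [f, g]) (fun j => by simp [f, g]) i
  · refine Prod.ext rfl (funext fun i => ?_)
    refine Fin.cases (by simp [f, g]) (fun i => ?_) i
    refine Fin.addCases (fun i => by simp [f, g]) (fun i => ?_) i
    refine Fin.cases (by simp [f, g]) (fun i => ?_) i
    exact Fin.addCases (fun i => by simp [f, g]) (fun j => by simp [f, g]) i
  · funext i
    refine Fin.cases (by simp [M, N, Matrix.mulVec]) (fun i => ?_) i
    refine Fin.addCases (fun i => by simp [M, N, Matrix.mulVec]) (fun i => ?_) i
    refine Fin.cases (by simp [M, N, Matrix.mulVec, dotProduct, sub_mul, add_mul,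
      Finset.sum_sub_distrib, Finset.sum_add_distrib, Pi.single_apply]) (fun i => ?_) i
    exact Fin.addCases (fun i => by simp [M, N, Matrix.mulVec])
      (fun j => by simp [M, N, Matrix.mulVec]) i
  · funext i
    refine Fin.cases (by simp [M, N, Matrix.mulVec, dotProduct, sub_mul, add_mul,
      Finset.sum_sub_distrib, Finset.sum_add_distrib, Pi.single_apply]) (fun i => ?_) i
    refine Fin.addCases (fun i => ?_) (fun k => by simp [M, N, Matrix.mulVec]) i
    refine Fin.cases (by simp [M, N, Matrix.mulVec]) (fun i => ?_) i
    exact Fin.addCases (fun i => by simp [M, N, Matrix.mulVec])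
      (fun j => by simp [M, N, Matrix.mulVec]) i
  · refine Prod.ext rfl (funext fun i => ?_)
    refine Fin.cases (by simp [f, M, Pi.single_apply]) (fun i => ?_) i
    refine Fin.addCases (fun i => by simp [f, M, Pi.single_apply]) (fun i => ?_) i
    refine Fin.cases ?_ (fun i => ?_) i
    · simp [f, M, Pi.single_apply, sub_smul]
    exact Fin.addCases (fun i => by simp [f, M, Pi.single_apply])
      (fun j => by simp [f, M, Pi.single_apply]) i

/-- The block matrix acting on `(α, b, c)` by `(α, α k + M b, c)`. -/
def blockMat {n n' : ℕ} (m : ℕ) (M : Matrix (Fin n') (Fin n) ℤ) (k : Fin n' → ℤ) :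
    Matrix (Fin (n' + m + 1)) (Fin (n + m + 1)) ℤ :=
  Fin.cons (Pi.single 0 1) (Fin.append (fun i => Fin.cons (k i) (Fin.append (M i) 0))
    (fun j => Pi.single (Fin.natAdd n j).succ 1))

theorem blockMat_mulVec {n n' : ℕ} (m : ℕ) (M : Matrix (Fin n') (Fin n) ℤ) (k : Fin n' → ℤ)
    (v : Fin (n + m + 1) → ℤ) :
    (blockMat m M k).mulVec v = Fin.cons (v 0)
      (Fin.append (fun i => k i * v 0 + M.mulVec (fun l => v (Fin.castAdd m l).succ) i)
        (fun j => v (Fin.natAdd n j).succ)) := by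
  funext i
  refine Fin.cases (by simp [blockMat, Matrix.mulVec]) (fun i => ?_) i
  refine Fin.addCases (fun i => ?_) (fun j => by simp [blockMat, Matrix.mulVec]) i
  simp [blockMat, Fin.sum_univ_succ, Fin.sum_univ_add, Matrix.mulVec, dotProduct]

theorem blockMat_inv {n n' : ℕ} (m : ℕ) (M : Matrix (Fin n') (Fin n) ℤ)
    (N : Matrix (Fin n) (Fin n') ℤ) (k : Fin n' → ℤ) (k' : Fin n → ℤ) (h : M * N = 1)
    (hk : k + M.mulVec k' = 0) (v : Fin (n' + m + 1) → ℤ) :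
    (blockMat m M k).mulVec ((blockMat m N k').mulVec v) = v := by
  rw [blockMat_mulVec, blockMat_mulVec]
  funext i
  refine Fin.cases (by simp) (fun i => ?_) i
  refine Fin.addCases (fun i => ?_) (fun j => by simp) i
  simp only [Fin.cons_zero, Fin.cons_succ, Fin.append_left]
  have h1 : (fun l => k' l * v 0 + N.mulVec (fun l => v (Fin.castAdd m l).succ) l) =
      v 0 • k' + N.mulVec (fun l => v (Fin.castAdd m l).succ) := by
    funext l; simp [mul_comm]
  rw [h1, Matrix.mulVec_add, Matrix.mulVec_smul, Matrix.mulVec_mulVec, h, Matrix.one_mulVec]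
  have h2 := congrFun hk i
  simp only [Pi.add_apply, Pi.zero_apply] at h2
  simp only [Pi.add_apply, Pi.smul_apply, smul_eq_mul]
  linear_combination (v 0) * h2

theorem DefFn.Iso.conv_right {A : AddSubgroup Γ} {n n' m : ℕ} {F : DefFn A n} {F' : DefFn A n'}
    (h : F.Iso F') (G : DefFn A m) : (F.conv G).Iso (F'.conv G) := by
  obtain ⟨f, hf, r, P, hP, hdisj, hcov, hpc⟩ := h
  have hfst : ∀ p ∈ F.carrier, (f p).1 = p.1 := by
    intro p hp
    rw [hcov] at hp
    obtain ⟨j, hj⟩ := Set.mem_iUnion.mp hp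
    obtain ⟨M, N, a, k, -, -, -, h⟩ := hpc j
    rw [h p hj]
  let F₁ (p : Γ × (Fin (n + m + 1) → Γ)) : Γ × (Fin (n' + m + 1) → Γ) :=
    (p.1, Fin.cons (p.2 0) (Fin.append (f (convLeft n m p)).2 (convRight n m p).2))
  have hL : ∀ p ∈ (F.conv G).carrier, convLeft n' m (F₁ p) = f (convLeft n m p) := by
    intro p hp
    refine Prod.ext ?_ ?_
    · rw [hfst _ hp.1]; simp [convLeft, F₁]
    · funext i; simp [convLeft, F₁]
  have hR : ∀ p, convRight n' m (F₁ p) = convRight n m p := by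
    intro p
    refine Prod.ext ?_ ?_
    · simp [convRight, F₁]
    · funext i; simp [convRight, F₁]
  refine ⟨F₁, ⟨?_, ?_, ?_⟩, r, fun j => (F.conv G).carrier ∩ convLeft n m ⁻¹' P j,
    fun j => (F.conv G).definable.inter ((hP j).convLeft m), ?_, ?_, fun j => ?_⟩
  · intro p hp
    refine ⟨?_, ?_⟩
    · rw [hL p hp]; exact hf.mapsTo hp.1
    · rw [hR]; exact hp.2
  · intro p hp q hq hpq
    have h1 : convLeft n m p = convLeft n m q :=
      hf.injOn hp.1 hq.1 (by rw [← hL p hp, ← hL q hq, hpq])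
    have h2 : convRight n m p = convRight n m q := by rw [← hR p, ← hR q, hpq]
    refine Prod.ext (congrArg Prod.fst hpq :) (funext fun i => ?_)
    refine Fin.cases (congrArg Prod.fst h1 :) (fun i => ?_) i
    exact Fin.addCases (fun i => congrFun (congrArg Prod.snd h1) i)
      (fun j => congrFun (congrArg Prod.snd h2) j) i
  · intro q hq
    obtain ⟨b, hb, hbq⟩ := hf.surjOn hq.1
    have hb1 : b.1 = q.2 0 := by rw [← hfst b hb, hbq]; rfl
    let p : Γ × (Fin (n + m + 1) → Γ) :=
      (q.1, Fin.cons (q.2 0) (Fin.append b.2 (convRight n' m q).2))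
    have hpl : convLeft n m p = b := by
      refine Prod.ext ?_ ?_
      · simp [convLeft, p, hb1]
      · funext i; simp [convLeft, p]
    have hpr : convRight n m p = convRight n' m q := by
      refine Prod.ext ?_ ?_
      · simp [convRight, p]
      · funext i; simp [convRight, p]
    refine ⟨p, ⟨by rw [hpl]; exact hb, by rw [hpr]; exact hq.2⟩, ?_⟩
    refine Prod.ext rfl (funext fun i => ?_)
    refine Fin.cases (by simp [F₁, p]) (fun i => ?_) i
    refine Fin.addCases (fun i => ?_) (fun j => ?_) i
    · simp only [F₁, hpl, hbq, Fin.cons_succ, Fin.append_left]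
      rfl
    · simp only [F₁, hpr, Fin.cons_succ, Fin.append_right]
      rfl
  · intro i j hij
    exact ((hdisj hij).preimage _).mono Set.inter_subset_right Set.inter_subset_right
  · rw [← Set.inter_iUnion, ← Set.preimage_iUnion, ← hcov]
    ext p
    exact ⟨fun hp => ⟨hp, hp.1⟩, fun hp => hp.1⟩
  · obtain ⟨M, N, a, k, hMN, hNM, ha, h⟩ := hpc j
    refine ⟨blockMat m M k, blockMat m N (-N.mulVec k), Fin.cons 0 (Fin.append a 0), 0, ?_, ?_, ?_, ?_⟩
    · refine Matrix.ext_iff_mulVec.mpr fun v => ?_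
      rw [← Matrix.mulVec_mulVec, Matrix.one_mulVec]
      exact blockMat_inv m M N k (-N.mulVec k) hMN (by rw [Matrix.mulVec_neg, Matrix.mulVec_mulVec, hMN,
        Matrix.one_mulVec, add_neg_cancel]) v
    · refine Matrix.ext_iff_mulVec.mpr fun v => ?_
      rw [← Matrix.mulVec_mulVec, Matrix.one_mulVec]
      exact blockMat_inv m N M (-N.mulVec k) k hNM (neg_add_cancel _) v
    · refine fun i => Fin.cases (by simp) (fun i => ?_) i
      exact Fin.addCases (fun i => by simpa using ha i) (fun j => by simp) i
    · rintro p ⟨hp, hpj⟩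
      refine Prod.ext rfl (funext fun i => ?_)
      refine Fin.cases (by simp [F₁, blockMat, Pi.single_apply]) (fun i => ?_) i
      refine Fin.addCases (fun i => ?_) (fun j => by simp [F₁, blockMat, Pi.single_apply, convRight]) i
      have h' := congrFun (congrArg Prod.snd (h _ hpj)) i
      simp only [F₁, Fin.cons_succ, Fin.append_left, h']
      simp [blockMat, Fin.sum_univ_succ, Fin.sum_univ_add, convLeft]
      abel

/-- Representatives in all dimensions; `⟨n, F⟩` stands for the function
`t ↦ [F(t)] / [0]₁ⁿ`. The product is convolution, `(F, n) * (G, m) = (F * G, n + m + 1)`. -/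
structure AnyFn (A : AddSubgroup Γ) where
  dim : ℕ
  fn : DefFn A dim

instance (A : AddSubgroup Γ) : Mul (AnyFn A) where
  mul F G := ⟨F.dim + G.dim + 1, F.fn.conv G.fn⟩

/-- The generator given by a representative. -/
noncomputable def gen {A : AddSubgroup Γ} {n : ℕ} (F : DefFn A n) : MonoidAlgebra ℚ (AnyFn A) :=
  MonoidAlgebra.single ⟨n, F⟩ 1

theorem gen_mul_gen {A : AddSubgroup Γ} {n m : ℕ} (F : DefFn A n) (G : DefFn A m) :
    gen F * gen G = gen (F.conv G) := by
  rw [gen, gen, MonoidAlgebra.single_mul_single, one_mul]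
  rfl

/-- The relations of the dimension-free Grothendieck group of functions: isomorphic families are
equal, disjoint unions are sums, and `(F, n)` is identified with `(F * q(0), n + 1)`. -/
inductive GrothendieckRel (A : AddSubgroup Γ) : MonoidAlgebra ℚ (AnyFn A) → Prop
  | iso {n m : ℕ} (F : DefFn A n) (F' : DefFn A m) : F.Iso F' →
      GrothendieckRel A (gen F - gen F')
  | disjUnion {n : ℕ} (F F₁ F₂ : DefFn A n) : F.carrier = F₁.carrier ∪ F₂.carrier →
      Disjoint F₁.carrier F₂.carrier → GrothendieckRel A (gen F - (gen F₁ + gen F₂))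
  | stab {n : ℕ} (F : DefFn A n) : GrothendieckRel A (gen (F.conv (DefFn.q₀ A)) - gen F)

/-- The `ℚ`-subspace spanned by the relations. -/
noncomputable def relSpan (A : AddSubgroup Γ) : Submodule ℚ (MonoidAlgebra ℚ (AnyFn A)) :=
  Submodule.span ℚ {x | GrothendieckRel A x}

theorem iso_mem {A : AddSubgroup Γ} {n m : ℕ} {F : DefFn A n} {F' : DefFn A m} (h : F.Iso F') :
    gen F - gen F' ∈ relSpan A :=
  Submodule.subset_span (GrothendieckRel.iso F F' h)

theorem stab_mem {A : AddSubgroup Γ} {n : ℕ} (F : DefFn A n) :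
    gen (F.conv (DefFn.q₀ A)) - gen F ∈ relSpan A :=
  Submodule.subset_span (GrothendieckRel.stab F)

theorem single_eq_smul_gen {A : AddSubgroup Γ} (F : AnyFn A) (r : ℚ) :
    MonoidAlgebra.single F r = r • gen F.fn := by
  rw [gen, MonoidAlgebra.smul_single, smul_eq_mul, mul_one]

theorem mul_comm_mem {A : AddSubgroup Γ} (x y : MonoidAlgebra ℚ (AnyFn A)) :
    x * y - y * x ∈ relSpan A := by
  induction x using MonoidAlgebra.induction_linear with
  | zero => simp
  | add x x' h h' =>
    convert add_mem h h' using 1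
    rw [add_mul, mul_add]; abel
  | single F r =>
    induction y using MonoidAlgebra.induction_linear with
    | zero => simp
    | add y y' h h' =>
      convert add_mem h h' using 1
      rw [add_mul, mul_add]; abel
    | single G s =>
      rw [single_eq_smul_gen, single_eq_smul_gen, smul_mul_smul_comm, smul_mul_smul_comm,
        mul_comm s r, ← smul_sub, gen_mul_gen, gen_mul_gen]
      exact Submodule.smul_mem _ _ (iso_mem (F.fn.conv_comm G.fn))

theorem mul_assoc_mem {A : AddSubgroup Γ} (x y z : MonoidAlgebra ℚ (AnyFn A)) :
    x * y * z - x * (y * z) ∈ relSpan A := by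
  induction x using MonoidAlgebra.induction_linear with
  | zero => simp
  | add x x' h h' =>
    convert add_mem h h' using 1
    simp only [add_mul]; abel
  | single F r =>
    induction y using MonoidAlgebra.induction_linear with
    | zero => simp
    | add y y' h h' =>
      convert add_mem h h' using 1
      simp only [add_mul, mul_add]; abel
    | single G s =>
      induction z using MonoidAlgebra.induction_linear with
      | zero => simp
      | add z z' h h' =>
        convert add_mem h h' using 1
        simp only [mul_add]; abel
      | single H t =>
        rw [single_eq_smul_gen, single_eq_smul_gen, single_eq_smul_gen, smul_mul_smul_comm,
          smul_mul_smul_comm, smul_mul_smul_comm, smul_mul_smul_comm, mul_assoc, ← smul_sub,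
          gen_mul_gen, gen_mul_gen, gen_mul_gen, gen_mul_gen]
        exact Submodule.smul_mem _ _ (iso_mem (F.fn.conv_assoc G.fn H.fn))

theorem mul_one_mem {A : AddSubgroup Γ} (x : MonoidAlgebra ℚ (AnyFn A)) :
    x * gen (DefFn.q₀ A) - x ∈ relSpan A := by
  induction x using MonoidAlgebra.induction_linear with
  | zero => simp
  | add x x' h h' =>
    convert add_mem h h' using 1
    rw [add_mul]; abel
  | single F r =>
    rw [single_eq_smul_gen, smul_mul_assoc, ← smul_sub, gen_mul_gen]
    exact Submodule.smul_mem _ _ (stab_mem F.fn)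

/-- The relations form an ideal: convolution is well defined on classes. -/
theorem mul_mem_right {A : AddSubgroup Γ} {x : MonoidAlgebra ℚ (AnyFn A)} (hx : x ∈ relSpan A)
    (y : MonoidAlgebra ℚ (AnyFn A)) : x * y ∈ relSpan A := by
  induction y using MonoidAlgebra.induction_linear with
  | zero => simp
  | add y y' h h' => rw [mul_add]; exact add_mem h h'
  | single G s =>
    rw [single_eq_smul_gen, mul_smul_comm]
    refine Submodule.smul_mem _ _ ?_
    induction hx using Submodule.span_induction with
    | zero => simp
    | add x x' _ _ h h' => rw [add_mul]; exact add_mem h h'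
    | smul r x _ h => rw [smul_mul_assoc]; exact Submodule.smul_mem _ _ h
    | mem x hx =>
      cases hx with
      | iso F F' h =>
        rw [sub_mul, gen_mul_gen, gen_mul_gen]
        exact iso_mem (h.conv_right G.fn)
      | disjUnion F F₁ F₂ h h' =>
        rw [sub_mul, add_mul, gen_mul_gen, gen_mul_gen, gen_mul_gen]
        refine Submodule.subset_span (GrothendieckRel.disjUnion _ _ _ ?_ ?_)
        · ext p
          simp only [DefFn.conv, h, Set.mem_union, Set.mem_ofPred_eq, or_and_right]
        · exact Set.disjoint_left.mpr fun p hp hp' => Set.disjoint_left.mp h' hp.1 hp'.1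
      | stab F =>
        set g := gen G.fn
        set f := gen F
        set o := gen (DefFn.q₀ A)
        rw [← gen_mul_gen]
        have h1 := mul_comm_mem (f * o) g
        have h2 := mul_assoc_mem g f o
        have h3 := mul_one_mem (g * f)
        have h4 := mul_comm_mem g f
        convert add_mem (sub_mem h1 h2) (add_mem h3 h4) using 1
        rw [sub_mul]; abel

theorem mul_mem_left {A : AddSubgroup Γ} {x : MonoidAlgebra ℚ (AnyFn A)} (hx : x ∈ relSpan A)
    (y : MonoidAlgebra ℚ (AnyFn A)) : y * x ∈ relSpan A := by
  convert add_mem (mul_comm_mem y x) (mul_mem_right hx y) using 1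
  abel

/-- Equality of classes. -/
noncomputable def fnCon (A : AddSubgroup Γ) : RingCon (MonoidAlgebra ℚ (AnyFn A)) where
  r x y := x - y ∈ relSpan A
  iseqv := by
    refine ⟨fun x => by simp, fun {x y} h => ?_, fun {x y z} h h' => ?_⟩
    · rw [← neg_sub]; exact neg_mem h
    · convert add_mem h h' using 1; abel
  add' {w x y z} h h' := by
    convert add_mem h h' using 1; abel
  mul' {w x y z} h h' := by
    convert add_mem (mul_mem_right h y) (mul_mem_left h' x) using 1
    rw [sub_mul, mul_sub]; abel

/-- The ring `ℛ^Γ` of definable functions from `Γ`, with support bounded below, to the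
dimension-free Grothendieck ring (with rational coefficients) of bounded definable sets; the
product is convolution. -/
noncomputable def RGamma (A : AddSubgroup Γ) : Type _ := (fnCon A).Quotient

namespace RGamma

variable (A : AddSubgroup Γ)

noncomputable instance : NonUnitalNonAssocRing (RGamma A) :=
  inferInstanceAs (NonUnitalNonAssocRing (fnCon A).Quotient)

/-- The class of a formal `ℚ`-combination of representatives. -/
noncomputable def mk (x : MonoidAlgebra ℚ (AnyFn A)) : RGamma A := (x : (fnCon A).Quotient)

variable {A}

theorem mk_surjective : Function.Surjective (mk A) := fun x => Quotient.exists_rep x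

theorem mk_eq_mk {x y : MonoidAlgebra ℚ (AnyFn A)} : mk A x = mk A y ↔ x - y ∈ relSpan A :=
  (fnCon A).eq

theorem mk_mul (x y : MonoidAlgebra ℚ (AnyFn A)) : mk A (x * y) = mk A x * mk A y := rfl

theorem mk_add (x y : MonoidAlgebra ℚ (AnyFn A)) : mk A (x + y) = mk A x + mk A y := rfl

variable (A)

noncomputable instance : CommRing (RGamma A) where
  __ := (inferInstance : NonUnitalNonAssocRing (RGamma A))
  one := mk A (gen (DefFn.q₀ A))
  mul_comm := mk_surjective.forall₂.mpr fun x y => mk_eq_mk.mpr (mul_comm_mem x y)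
  mul_assoc := mk_surjective.forall₃.mpr fun x y z => mk_eq_mk.mpr (mul_assoc_mem x y z)
  mul_one := mk_surjective.forall.mpr fun x => mk_eq_mk.mpr (mul_one_mem x)
  one_mul := mk_surjective.forall.mpr fun x => mk_eq_mk.mpr (by
    convert add_mem (mul_comm_mem (gen (DefFn.q₀ A)) x) (mul_one_mem x) using 1
    abel)

/-- The class of a representative. -/
noncomputable def cls {A : AddSubgroup Γ} {n : ℕ} (F : DefFn A n) : RGamma A := mk A (gen F)

theorem cls_mul {A : AddSubgroup Γ} {n m : ℕ} (F : DefFn A n) (G : DefFn A m) :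
    cls F * cls G = cls (F.conv G) := by
  rw [cls, cls, ← mk_mul, gen_mul_gen]
  rfl

/-- The element `θ_m = ∫_{t ≥ 0} q(m t) dt`. -/
noncomputable def theta (m : ℕ+) : RGamma A := cls (DefFn.theta A m)

end RGamma

end Functions

end VolGamma

/-!
A point of the product `θ_m θ_k` over `γ` is a pair `b, c ≥ 0` with `γ = m b + k c`, together with
the redundant coordinate `α = m b`. The identity is the subdivision of the quadrant
`{(b, c) : b, c ≥ 0}` of `θ_n θ` along its diagonal. The half `b ≤ c` is the image of the quadrant
of `θ_{n+1} θ` under the unimodular map `(b, c) ↦ (b, b + c)`, because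
`(n + 1) b + c = n b + (b + c)` (`theta_conv_iso_of_le`). The half `c < b` is the image of the part
`0 < c` of the quadrant of `θ_{n+1} θ_n` under `(b, c) ↦ (b + c, b)`, because
`(n + 1) b + n c = n (b + c) + b` (`theta_conv_iso_of_lt`); the missing edge `c = 0` is a copy
of `θ_{n+1}` (`theta_conv_iso_edge`). This gives `θ_n θ = θ_{n+1} θ + (θ_{n+1} θ_n - θ_{n+1})`.

Where `θ` has an inverse `s`, the identity reads `θ_{n+1} (1 - (1 - s)(1 - θ_n⁻¹)) = 1` after
division by `θ θ_n`, so `1 - θ_{n+1}⁻¹ = (1 - s)(1 - θ_n⁻¹)`, and induction on `n` finishes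
(`mul_one_sub_pow_eq_one`).
-/

namespace VolGamma

variable {Γ : Type*} [AddCommGroup Γ] [LinearOrder Γ] [IsOrderedAddMonoid Γ] [Module ℚ Γ]
  [Nontrivial Γ]

/-- The restriction of a family to a definable set. -/
def DefFn.restrict {A : AddSubgroup Γ} {n : ℕ} (F : DefFn A n) (S : Set (Γ × (Fin n → Γ)))
    (hS : Definable A S) : DefFn A n where
  carrier := F.carrier ∩ S
  definable := F.definable.inter hS
  bounded t := (F.bounded t).imp fun _ h x hx => h x hx.1
  support_bddBelow := F.support_bddBelow.imp fun _ h p hp => h p hp.1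

namespace RGamma

theorem cls_eq_of_iso {A : AddSubgroup Γ} {n m : ℕ} {F : DefFn A n} {F' : DefFn A m}
    (h : F.Iso F') : cls F = cls F' :=
  mk_eq_mk.mpr (iso_mem h)

theorem cls_conv_q₀ {A : AddSubgroup Γ} {n : ℕ} (F : DefFn A n) :
    cls (F.conv (DefFn.q₀ A)) = cls F :=
  mk_eq_mk.mpr (stab_mem F)

theorem cls_eq_restrict_add_restrict_compl {A : AddSubgroup Γ} {n : ℕ} (F : DefFn A n)
    (S : Set (Γ × (Fin n → Γ))) (hS : Definable A S) :
    cls F = cls (F.restrict S hS) + cls (F.restrict Sᶜ hS.compl) := by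
  refine mk_eq_mk.mpr (Submodule.subset_span (GrothendieckRel.disjUnion _ _ _ ?_ ?_))
  · exact (Set.inter_union_compl F.carrier S).symm
  · exact disjoint_compl_right.mono Set.inter_subset_right Set.inter_subset_right

end RGamma

theorem mem_theta_conv_theta {A : AddSubgroup Γ} {m k : ℕ+}
    {p : Γ × (Fin (1 + 1 + 1) → Γ)} :
    p ∈ ((DefFn.theta A m).conv (DefFn.theta A k)).carrier ↔
      (0 ≤ p.2 1 ∧ p.2 0 = (m : ℕ) • p.2 1) ∧ (0 ≤ p.2 2 ∧ p.1 - p.2 0 = (k : ℕ) • p.2 2) :=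
  Iff.rfl

/-- The part `b ≤ c` of `Γ × Γ³`, in the coordinates `(γ, (α, b, c))`. -/
theorem definable_le (A : AddSubgroup Γ) :
    Definable A {p : Γ × (Fin (1 + 1 + 1) → Γ) | p.2 1 ≤ p.2 2} := by
  simpa only [sub_nonneg] using
    Definable.nonneg_of_isAffine ((IsAffine.coord (A := A) (n := 1 + 1 + 1) 2).sub (.coord 1))

/-- The part `c = 0` of `Γ × Γ³`, in the coordinates `(γ, (α, b, c))`. -/
theorem definable_eq_zero (A : AddSubgroup Γ) :
    Definable A {p : Γ × (Fin (1 + 1 + 1) → Γ) | p.2 2 = 0} :=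
  Definable.eq_of_isAffine (.coord 2) (.const A.zero_mem)

/-- The quadrant of `θ_{n+1} θ` is the half `b ≤ c` of the quadrant of `θ_n θ`. -/
theorem theta_conv_iso_of_le (A : AddSubgroup Γ) (n : ℕ+) :
    ((DefFn.theta A (n + 1)).conv (DefFn.theta A 1)).Iso
      (((DefFn.theta A n).conv (DefFn.theta A 1)).restrict _ (definable_le A)) := by
  refine DefFn.Iso.of_affine
    (fun p => (p.1, ![p.2 0 - p.2 1, p.2 1, p.2 1 + p.2 2]))
    (fun p => (p.1, ![p.2 0 + p.2 1, p.2 1, p.2 2 - p.2 1]))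
    ?_ ?_ ?_ ?_ !![1, -1, 0; 0, 1, 0; 0, 1, 1] !![1, 1, 0; 0, 1, 0; 0, -1, 1] 0 ?_ ?_ ?_
  · rintro ⟨t, x⟩ hp
    obtain ⟨⟨hb, ha⟩, hc, h⟩ := mem_theta_conv_theta.mp hp
    refine ⟨mem_theta_conv_theta.mpr ⟨⟨hb, ?_⟩, add_nonneg hb hc, ?_⟩,
      le_add_of_nonneg_right hc⟩
    · simp_all [add_smul]
    · simp_all [add_smul, sub_eq_iff_eq_add]; abel
  · rintro ⟨t, x⟩ ⟨hp, hle⟩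
    obtain ⟨⟨hb, ha⟩, hc, h⟩ := mem_theta_conv_theta.mp hp
    refine mem_theta_conv_theta.mpr ⟨⟨hb, ?_⟩, sub_nonneg.mpr hle, ?_⟩
    · simp_all [add_smul]
    · simp_all [sub_eq_iff_eq_add]
  · intro p _
    refine Prod.ext rfl (funext fun i => ?_)
    fin_cases i <;> simp
  · intro p _
    refine Prod.ext rfl (funext fun i => ?_)
    fin_cases i <;> simp
  · intro v
    funext i
    fin_cases i <;> simp [Matrix.mulVec, dotProduct, Fin.sum_univ_succ]
  · intro v
    funext i
    fin_cases i <;> simp [Matrix.mulVec, dotProduct, Fin.sum_univ_succ]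
  · intro p
    refine Prod.ext rfl (funext fun i => ?_)
    fin_cases i <;> simp [Fin.sum_univ_succ, sub_eq_add_neg]

/-- The part `0 < c` of the quadrant of `θ_{n+1} θ_n` is the half `c < b` of the quadrant
of `θ_n θ`. -/
theorem theta_conv_iso_of_lt (A : AddSubgroup Γ) (n : ℕ+) :
    (((DefFn.theta A (n + 1)).conv (DefFn.theta A n)).restrict _
      (definable_eq_zero A).compl).Iso
      (((DefFn.theta A n).conv (DefFn.theta A 1)).restrict _ (definable_le A).compl) := by
  -- The old `α` is `(n + 1) b` and the new one is `n (b + c) = α - b + n c`, which keeps the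
  -- map unimodular.
  refine DefFn.Iso.of_affine
    (fun p => (p.1, ![p.2 0 - p.2 1 + (n : ℤ) • p.2 2, p.2 1 + p.2 2, p.2 1]))
    (fun p => (p.1, ![p.2 0 + p.2 2 - (n : ℤ) • (p.2 1 - p.2 2), p.2 2, p.2 1 - p.2 2]))
    ?_ ?_ ?_ ?_ !![1, -1, (n : ℤ); 0, 1, 1; 0, 1, 0] !![1, -(n : ℤ), 1 + n; 0, 0, 1; 0, 1, -1] 0
    ?_ ?_ ?_
  · rintro ⟨t, x⟩ ⟨hp, hne⟩
    obtain ⟨⟨hb, ha⟩, hc, h⟩ := mem_theta_conv_theta.mp hp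
    have hpos : 0 < x 2 := lt_of_le_of_ne hc (Ne.symm hne)
    refine ⟨mem_theta_conv_theta.mpr ⟨⟨add_nonneg hb hc, ?_⟩, hb, ?_⟩,
      not_le.mpr (lt_add_of_pos_right _ hpos)⟩
    · simp_all [add_smul]
    · simp_all [add_smul, sub_eq_iff_eq_add]; abel
  · rintro ⟨t, x⟩ ⟨hp, hlt⟩
    obtain ⟨⟨hb, ha⟩, hc, h⟩ := mem_theta_conv_theta.mp hp
    have hlt : x 2 < x 1 := not_le.mp hlt
    refine ⟨mem_theta_conv_theta.mpr ⟨⟨hc, ?_⟩, sub_nonneg.mpr hlt.le, ?_⟩,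
      (sub_pos.mpr hlt).ne'⟩
    · simp_all [add_smul, smul_sub]; abel
    · simp_all [smul_sub, sub_eq_iff_eq_add]
  · intro p _
    refine Prod.ext rfl (funext fun i => ?_)
    fin_cases i <;> simp; abel
  · intro p _
    refine Prod.ext rfl (funext fun i => ?_)
    fin_cases i <;> simp; abel
  · intro v
    funext i
    fin_cases i <;> simp [Matrix.mulVec, dotProduct, Fin.sum_univ_succ]; ring
  · intro v
    funext i
    fin_cases i <;> simp [Matrix.mulVec, dotProduct, Fin.sum_univ_succ]; ring
  · intro p
    refine Prod.ext rfl (funext fun i => ?_)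
    fin_cases i <;> simp [Fin.sum_univ_succ, sub_eq_add_neg, add_assoc]

/-- The edge `c = 0` of the quadrant of `θ_m θ_k` is a copy of `θ_m`. Two factors `q(0)` bring
`θ_m` to the same ambient dimension. -/
theorem theta_conv_iso_edge (A : AddSubgroup Γ) (m k : ℕ+) :
    (((DefFn.theta A m).conv (DefFn.theta A k)).restrict _ (definable_eq_zero A)).Iso
      (((DefFn.theta A m).conv (DefFn.q₀ A)).conv (DefFn.q₀ A)) := by
  have hmem : ∀ p : Γ × (Fin (1 + 0 + 1 + 0 + 1) → Γ),
      p ∈ (((DefFn.theta A m).conv (DefFn.q₀ A)).conv (DefFn.q₀ A)).carrier ↔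
        ((0 ≤ p.2 2 ∧ p.2 1 = (m : ℕ) • p.2 2) ∧ p.2 0 - p.2 1 = 0) ∧ p.1 - p.2 0 = 0 :=
    fun _ => Iff.rfl
  refine DefFn.Iso.of_affine (m := 1 + 0 + 1 + 0 + 1)
    (fun p => (p.1, ![p.2 0, p.2 0 + p.2 2, p.2 1]))
    (fun p => (p.1, ![p.2 0, p.2 2, p.2 1 - p.2 0]))
    ?_ ?_ ?_ ?_ !![1, 0, 0; 1, 0, 1; 0, 1, 0] !![1, 0, 0; 0, 0, 1; -1, 1, 0] 0 ?_ ?_ ?_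
  · rintro ⟨t, x⟩ ⟨hp, hz⟩
    obtain ⟨⟨hb, ha⟩, -, h⟩ := mem_theta_conv_theta.mp hp
    have hz : x 2 = 0 := hz
    refine (hmem _).mpr ⟨⟨⟨hb, ?_⟩, ?_⟩, ?_⟩ <;> simp_all
  · rintro ⟨t, x⟩ hp
    obtain ⟨⟨⟨hb, ha⟩, h0⟩, h1⟩ := (hmem _).mp hp
    have h0 : x 0 = x 1 := sub_eq_zero.mp h0
    have h1 : t = x 0 := sub_eq_zero.mp h1
    refine ⟨mem_theta_conv_theta.mpr ⟨⟨hb, ?_⟩, ?_, ?_⟩, ?_⟩ <;> simp_all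
  · intro p _
    refine Prod.ext rfl (funext fun i => ?_)
    fin_cases i <;> simp
  · intro p _
    refine Prod.ext rfl (funext fun i => ?_)
    fin_cases i <;> simp
  · intro v
    funext i
    fin_cases i <;> simp [Matrix.mulVec, dotProduct, Fin.sum_univ_succ]
  · intro v
    funext i
    fin_cases i <;> simp [Matrix.mulVec, dotProduct, Fin.sum_univ_succ]
  · intro p
    refine Prod.ext rfl (funext fun i => ?_)
    fin_cases i <;> simp [Fin.sum_univ_succ]

namespace RGamma

theorem theta_succ_mul (A : AddSubgroup Γ) (n : ℕ+) :
    theta A (n + 1) * (theta A 1 + theta A n - 1) = theta A n * theta A 1 := by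
  have h : theta A n * theta A 1 = _ := (cls_mul _ _).trans
    (cls_eq_restrict_add_restrict_compl _ _ (definable_le A))
  have h' : theta A (n + 1) * theta A n = _ := (cls_mul _ _).trans
    (cls_eq_restrict_add_restrict_compl _ _ (definable_eq_zero A))
  have h₁ : theta A (n + 1) * theta A 1 = _ :=
    (cls_mul _ _).trans (cls_eq_of_iso (theta_conv_iso_of_le A n))
  have h₂ := cls_eq_of_iso (theta_conv_iso_of_lt A n)
  have h₃ : _ = theta A (n + 1) := (cls_eq_of_iso (theta_conv_iso_edge A (n + 1) n)).trans
    ((cls_conv_q₀ _).trans (cls_conv_q₀ _))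
  rw [mul_sub, mul_add, mul_one, h₁, h', h₂, h₃, h]
  abel

end RGamma

/-- If `x_{n+1} (x_1 + x_n - 1) = x_n x_1` for all `n` and `x_1` has the inverse `s`, then `x_n` has
the inverse `1 - (1 - s) ^ n`. -/
theorem mul_one_sub_pow_eq_one {R : Type*} [CommRing R] (x : ℕ+ → R) (s : R) (hs : x 1 * s = 1)
    (hx : ∀ n, x (n + 1) * (x 1 + x n - 1) = x n * x 1) (n : ℕ+) :
    x n * (1 - (1 - s) ^ (n : ℕ)) = 1 := by
  induction n with
  | one => simpa using hs
  | succ n ih =>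
    rw [PNat.add_coe, PNat.one_coe, pow_succ]
    generalize (1 - s) ^ (n : ℕ) = w at ih ⊢
    -- By `hs` and `ih`, `s * (1 - w)` is the inverse of `x n * x 1`, the right side of `hx n`.
    linear_combination s * (1 - w) * hx n + (x 1 * s - x (n + 1) * s) * ih +
      (1 - x (n + 1) * (1 - w)) * hs

end VolGamma

theorem mainTheorem8 {Γ : Type*} [AddCommGroup Γ] [LinearOrder Γ] [IsOrderedAddMonoid Γ]
    [Module ℚ Γ] [Nontrivial Γ] (A : AddSubgroup Γ) (n : ℕ+) :
    VolGamma.RGamma.theta A (n + 1) *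
        (VolGamma.RGamma.theta A 1 + VolGamma.RGamma.theta A n - 1) =
      VolGamma.RGamma.theta A n * VolGamma.RGamma.theta A 1 ∧
    ∃ u : (Localization.Away (VolGamma.RGamma.theta A 1))ˣ,
      (u : Localization.Away (VolGamma.RGamma.theta A 1)) =
        algebraMap (VolGamma.RGamma A) (Localization.Away (VolGamma.RGamma.theta A 1))
          (VolGamma.RGamma.theta A n) ∧
      1 - ((u⁻¹ : (Localization.Away (VolGamma.RGamma.theta A 1))ˣ) :
          Localization.Away (VolGamma.RGamma.theta A 1)) =
        (1 - IsLocalization.Away.invSelf (VolGamma.RGamma.theta A 1)) ^ (n : ℕ) := by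
  have h := VolGamma.mul_one_sub_pow_eq_one
    (fun m => algebraMap (VolGamma.RGamma A) (Localization.Away (VolGamma.RGamma.theta A 1))
      (VolGamma.RGamma.theta A m)) _
    (IsLocalization.Away.mul_invSelf (VolGamma.RGamma.theta A 1))
    (fun m => by
      simpa only [map_mul, map_add, map_sub, map_one] using
        congrArg (algebraMap _ (Localization.Away (VolGamma.RGamma.theta A 1)))
          (VolGamma.RGamma.theta_succ_mul A m)) n
  exact ⟨VolGamma.RGamma.theta_succ_mul A n, Units.mkOfMulEqOne _ _ h, rfl, sub_sub_cancel _ _⟩
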